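/- Formulas and teams. Let $\tau$ be a first-order vocabulary. A model is a finite $\tau$-structure $M$ with at least two elements. A team in $M$ with domain $V$ (a finite set of variables) is a set $T$ of assignments $s\colon V\to M$; $M\models_T\phi$ is defined for formulas whose free variables lie in $V$. First-order logic is built from literals (atomic and negated atomic formulas) by $\wedge,\vee,\exists,\forall$, with team semantics: - a literal holds in $T$ iff every $s\in T$ satisfies it; - $M\models_T\phi\wedge\psi$ iff $M\models_T\phi$ and $M\models_T\psi$; $M\models_T\phi\vee\psi$ iff $T=U\cup W$ for some $U,W$ with $M\models_U\phi$ and $M\models_W\psi$; - $M\models_T\exists x\,\phi$ iff there is $F\colon T\to\mathcal P(M)\setminus\{\emptyset\}$ with $M\models_{T[F/x]}\phi$, where $T[F/x]=\{s(a/x): s\in T,\ a\in F(s)\}$; $M\models_T\forall x\,\phi$ iff $M\models_{T[M/x]}\phi$, where $T[M/x]=\{s(a/x): s\in T,\ a\in M\}$. Lindström quantifiers. For $r\ge 1$ and any class $\mathcal K$, closed under isomorphism, of structures $(A,R)$ with $R\subseteq A^r$, and for an $r$-tuple $\vec y$ of distinct variables, $M\models_T Q_{\mathcal K}\vec y\,\psi$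 iff there is $F\colon T\to\mathcal P(M^r)$ with $(M,F(s))\in\mathcal K$ for all $s\in T$ and $M\models_{T[F/\vec y]}\psi$, where $T[F/\vec y]=\{s(\vec b/\vec y): s\in T,\ \vec b\in F(s)\}$. Atoms. In atoms the entries of the tuples are terms ($s(t)$ denotes the value of $t$ under $s$). - Dependence $=\!(\vec x,y)$: for all $s,s'\in T$, $s(\vec x)=s'(\vec x)$ implies $s(y)=s'(y)$. It is $k$-ary if $\mathrm{len}(\vec x)=k\ge 0$. The constancy atom $=\!(\vec y)$ says that $s(\vec y)=s'(\vec y)$ for all $s,s'\in T$; being a conjunction of dependence atoms with empty $\vec x$, it counts as $0$-ary. - Exclusion $\vec x\mid\vec y$: $s(\vec x)\ne s'(\vec y)$ for all $s,s'\in T$. Inclusion $\vec x\subseteq\vec y$: for every $s\in T$ there is $s'\in T$ with $s(\vec x)=s'(\vec y)$. Both are $k$-ary if $\mathrm{len}(\vec x)=\mathrm{len}(\vec y)=k\ge 1$. - Anonymity $\vec x\mathrel\Upsilon y$: for every $s\in T$ there is $s'\in T$ with $s(\vec x)=s'(\vec x)$ and $s(y)\ne s'(y)$. It is $k$-ary if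 $\mathrm{len}(\vec x)=k\ge1$. - Independence $\vec x\perp_{\vec z}\vec y$ ($\vec x,\vec y$ non-empty): for all $s,s'\in T$ with $s(\vec z)=s'(\vec z)$ there is $s''\in T$ with $s''(\vec z)=s(\vec z)$, $s''(\vec x)=s(\vec x)$, $s''(\vec y)=s'(\vec y)$. It is $k$-ary if $\mathrm{len}(\vec z)+\max(\mathrm{len}(\vec x),\mathrm{len}(\vec y))=k$; it is pure if $\vec z$ is empty and conditional otherwise. - General atom $\alpha_C(\vec x)$, for any class $C$, closed under isomorphism, of pairs $(A,R)$ with $R\subseteq A^k$: $(M,\{s(\vec x): s\in T\})\in C$. It is $k$-ary if $\mathrm{len}(\vec x)=k\ge 0$. An atom $\alpha$ applied to pairwise distinct variables from $V$ is definable (on $V$) in a logic if some formula $\phi$ of the logic with free variables in $V$ satisfies $M\models_T\phi\iff M\models_T\alpha$ for all models $M$ and all teams $T$ in $M$ with domain $V$. Theorem. Let $k$ be a positive integer. For every vocabulary $\tau$ and every finite set $V$ of variables containing those of the atom in question (which are pairwise distinct): (a) No $k$-ary dependence atom is definable in the extension of first-order logic by all $<k$-ary atoms (dependence, independence, exclusion,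 inclusion, anonymity, constancy and general atoms), all $\le k$-ary independence (pure or conditional), exclusion, inclusion, anonymity and constancy atoms, and all Lindström quantifiers. (b) No $k$-ary exclusion atom is definable in the extension of first-order logic by all $<k$-ary atoms (of all the kinds above, including general atoms) and all Lindström quantifiers. (c) The same as (b) for $k$-ary inclusion atoms. (d) The same as (b) for $k$-ary anonymity atoms. (e) The same as (b) for $k$-ary independence atoms, pure or conditional: for all $p,q\ge1$ and $m\ge0$ with $m+\max(p,q)=k$, no independence atom $\vec x\perp_{\vec z}\vec y$ with $\mathrm{len}(\vec x)=p$, $\mathrm{len}(\vec y)=q$, $\mathrm{len}(\vec z)=m$ is definable in that logic. -/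

import Mathlib

universe u v

namespace TeamSem

/-- An isomorphism-closed class of pairs `(A, R)` with `R ⊆ A^r`. Such classes serve both as the
classes `𝒦` of Lindström quantifiers of type `(r)` and as the classes `C` of the general
`r`-ary atoms `α_C` (a team with an `r`-tuple of variables as domain is a subset of `A^r`). -/
structure RelClass (r : ℕ) where
  mem : (A : Type) → Set (Fin r → A) → Prop
  iso_closed : ∀ {A B : Type} (e : A ≃ B) (R : Set (Fin r → A)),
    mem A R → mem B ((fun (a : Fin r → A) (i : Fin r) => e (a i)) '' R)

/-- The atoms of team semantics, applied to tuples of elements of `τ` (the terms). -/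
inductive Atom (τ : Type u) : Type (max u 1)
  /-- Dependence atom `=(x, y)`; the tuple `x` may be empty. -/
  | dep {k : ℕ} (x : Fin k → τ) (y : τ) : Atom τ
  /-- Constancy atom `=(y)` for a tuple `y`. -/
  | const {k : ℕ} (y : Fin k → τ) : Atom τ
  /-- Exclusion atom `x | y`. -/
  | excl {k : ℕ} (hk : 0 < k) (x y : Fin k → τ) : Atom τ
  /-- Inclusion atom `x ⊆ y`. -/
  | incl {k : ℕ} (hk : 0 < k) (x y : Fin k → τ) : Atom τ
  /-- Anonymity atom `x Υ y`. -/
  | anon {k : ℕ} (hk : 0 < k) (x : Fin k → τ) (y : τ) : Atom τ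
  /-- Independence atom `x ⊥_z y`; it is pure if `z` is empty, and conditional otherwise. -/
  | indep {k l m : ℕ} (hk : 0 < k) (hl : 0 < l)
      (x : Fin k → τ) (y : Fin l → τ) (z : Fin m → τ) : Atom τ
  /-- General atom `α_C(x)`. -/
  | general {k : ℕ} (C : RelClass k) (x : Fin k → τ) : Atom τ

namespace Atom

/-- The arity of an atom. The constancy atom `=(y)` of a single `y` is the dependence atom with
an empty first tuple, hence `0`-ary; for a tuple it abbreviates a conjunction of such atoms and
is given arity `0` as well. -/
def arity {τ : Type u} : Atom τ → ℕ
  | @dep _ k _ _ => k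
  | @const _ _ _ => 0
  | @excl _ k _ _ _ => k
  | @incl _ k _ _ _ => k
  | @anon _ k _ _ _ => k
  | @indep _ k l m _ _ _ _ _ => m + max k l
  | @general _ k _ _ => k

/-- The independence, exclusion, inclusion, anonymity and constancy atoms. -/
def NotDepNorGeneral {τ : Type u} : Atom τ → Prop
  | dep _ _ => False
  | general _ _ => False
  | _ => True

/-- Truth of an atom in a team `T ⊆ S` of assignments; `ev s t` is the value of the term `t`
under the assignment `s`. -/
def Sat {τ : Type u} {S M : Type} (ev : S → τ → M) (T : Set S) : Atom τ → Prop
  | dep x y => ∀ s ∈ T, ∀ s' ∈ T, (∀ i, ev s (x i) = ev s' (x i)) → ev s y = ev s' y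
  | const y => ∀ s ∈ T, ∀ s' ∈ T, ∀ i, ev s (y i) = ev s' (y i)
  | excl _ x y => ∀ s ∈ T, ∀ s' ∈ T, ¬ ∀ i, ev s (x i) = ev s' (y i)
  | incl _ x y => ∀ s ∈ T, ∃ s' ∈ T, ∀ i, ev s (x i) = ev s' (y i)
  | anon _ x y => ∀ s ∈ T, ∃ s' ∈ T, (∀ i, ev s (x i) = ev s' (x i)) ∧ ev s y ≠ ev s' y
  | indep _ _ x y z => ∀ s ∈ T, ∀ s' ∈ T, (∀ i, ev s (z i) = ev s' (z i)) →
      ∃ s'' ∈ T, (∀ i, ev s'' (z i) = ev s (z i)) ∧ (∀ i, ev s'' (x i) = ev s (x i)) ∧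
        ∀ i, ev s'' (y i) = ev s' (y i)
  | general C x => C.mem M ((fun s i => ev s (x i)) '' T)

end Atom

/-- Formulas, over the vocabulary `L`, of first-order logic (in negation normal form) extended by
all atoms and by all Lindström quantifiers of type `(r)`, `r ≥ 1`. Variables are the natural
numbers; an element of `Fmla L V` is a formula interpreted in teams with domain `V` (its free
variables lie in `V`). -/
inductive Fmla (L : FirstOrder.Language.{u, v}) : Finset ℕ → Type (max u v 1)
  | eq {V : Finset ℕ} (t₁ t₂ : L.Term V) : Fmla L V
  | neq {V : Finset ℕ} (t₁ t₂ : L.Term V) : Fmla L V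
  | rel {V : Finset ℕ} {n : ℕ} (R : L.Relations n) (t : Fin n → L.Term V) : Fmla L V
  | nrel {V : Finset ℕ} {n : ℕ} (R : L.Relations n) (t : Fin n → L.Term V) : Fmla L V
  | atom {V : Finset ℕ} (α : Atom (L.Term V)) : Fmla L V
  | and {V : Finset ℕ} (φ ψ : Fmla L V) : Fmla L V
  | or {V : Finset ℕ} (φ ψ : Fmla L V) : Fmla L V
  | ex {V : Finset ℕ} (x : ℕ) (φ : Fmla L (insert x V)) : Fmla L V
  | all {V : Finset ℕ} (x : ℕ) (φ : Fmla L (insert x V)) : Fmla L V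
  | quant {V : Finset ℕ} {r : ℕ} (hr : 0 < r) (K : RelClass r) (y : Fin r ↪ ℕ)
      (φ : Fmla L (V ∪ Finset.univ.map y)) : Fmla L V

/-- The team `T[F/x] = {s(a/x) | s ∈ T, a ∈ F(s)}`. -/
def supp {V : Finset ℕ} {M : Type} (T : Set (V → M)) (x : ℕ) (F : (V → M) → Set M) :
    Set (↥(insert x V) → M) :=
  {t | ∃ s ∈ T, ∃ a ∈ F s, t ⟨x, Finset.mem_insert_self x V⟩ = a ∧
    ∀ (z : ℕ) (hz : z ∈ V), z ≠ x → t ⟨z, Finset.mem_insert_of_mem hz⟩ = s ⟨z, hz⟩}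

/-- The team `T[F/y] = {s(b/y) | s ∈ T, b ∈ F(s)}` for a tuple `y` of distinct variables. -/
def suppTuple {V : Finset ℕ} {M : Type} {r : ℕ} (T : Set (V → M)) (y : Fin r ↪ ℕ)
    (F : (V → M) → Set (Fin r → M)) : Set (↥(V ∪ Finset.univ.map y) → M) :=
  {t | ∃ s ∈ T, ∃ b ∈ F s,
    (∀ i : Fin r, t ⟨y i, Finset.mem_union_right V
      (Finset.mem_map_of_mem y (Finset.mem_univ i))⟩ = b i) ∧
    ∀ (z : ℕ) (hz : z ∈ V), (∀ i, z ≠ y i) → t ⟨z, Finset.mem_union_left _ hz⟩ = s ⟨z, hz⟩}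

namespace Fmla

variable {L : FirstOrder.Language.{u, v}}

/-- Team semantics: `φ.Sat T` says that `M ⊨_T φ`. -/
def Sat {M : Type} [L.Structure M] : {V : Finset ℕ} → Fmla L V → Set (V → M) → Prop
  | _, eq t₁ t₂, T => ∀ s ∈ T, t₁.realize s = t₂.realize s
  | _, neq t₁ t₂, T => ∀ s ∈ T, t₁.realize s ≠ t₂.realize s
  | _, rel R t, T => ∀ s ∈ T, FirstOrder.Language.Structure.RelMap R (fun i => (t i).realize s)
  | _, nrel R t, T => ∀ s ∈ T, ¬ FirstOrder.Language.Structure.RelMap R (fun i => (t i).realize s)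
  | _, atom α, T => α.Sat (fun s t => t.realize s) T
  | _, and φ ψ, T => φ.Sat T ∧ ψ.Sat T
  | _, or φ ψ, T => ∃ U W, T = U ∪ W ∧ φ.Sat U ∧ ψ.Sat W
  | _, @ex _ V x φ, T =>
      ∃ F : (V → M) → Set M, (∀ s ∈ T, (F s).Nonempty) ∧ φ.Sat (supp T x F)
  | _, all x φ, T => φ.Sat (supp T x fun _ => Set.univ)
  | _, @quant _ V r _ K y φ, T =>
      ∃ F : (V → M) → Set (Fin r → M), (∀ s ∈ T, K.mem M (F s)) ∧ φ.Sat (suppTuple T y F)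

/-- All atoms occurring in the formula (apart from literals) satisfy `P`. -/
def AtomsIn (P : (V : Finset ℕ) → Atom (L.Term V) → Prop) : {V : Finset ℕ} → Fmla L V → Prop
  | _, eq _ _ => True
  | _, neq _ _ => True
  | _, rel _ _ => True
  | _, nrel _ _ => True
  | V, atom α => P V α
  | _, and φ ψ => φ.AtomsIn P ∧ ψ.AtomsIn P
  | _, or φ ψ => φ.AtomsIn P ∧ ψ.AtomsIn P
  | _, ex _ φ => φ.AtomsIn P
  | _, all _ φ => φ.AtomsIn P
  | _, quant _ _ _ φ => φ.AtomsIn P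

end Fmla

/-- The atom `α` is definable, on finite models with at least two elements and teams with
domain `V`, in first-order logic extended by the atoms satisfying `P` and all Lindström
quantifiers. -/
def Definable (L : FirstOrder.Language.{u, v}) (P : (V : Finset ℕ) → Atom (L.Term V) → Prop)
    {V : Finset ℕ} (α : Atom (L.Term V)) : Prop :=
  ∃ φ : Fmla L V, φ.AtomsIn P ∧
    ∀ (M : Type) [Finite M] [Nontrivial M] [L.Structure M] (T : Set (V → M)),
      φ.Sat T ↔ α.Sat (fun s t => t.realize s) T

/-- Atoms of arity less than `k`. -/
def Below (L : FirstOrder.Language.{u, v}) (k : ℕ) (V : Finset ℕ) (α : Atom (L.Term V)) : Prop :=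
  α.arity < k

/-- Atoms of arity less than `k`, together with the independence, exclusion, inclusion, anonymity
and constancy atoms of arity at most `k`. -/
def BelowOrNonDep (L : FirstOrder.Language.{u, v}) (k : ℕ) (V : Finset ℕ) (α : Atom (L.Term V)) : Prop :=
  α.arity < k ∨ (α.arity ≤ k ∧ α.NotDepNorGeneral)

/-- A tuple of variables as a tuple of terms. -/
def vars (L : FirstOrder.Language.{u, v}) {V : Finset ℕ} {k : ℕ} (x : Fin k → V) : Fin k → L.Term V :=
  fun i => FirstOrder.Language.Term.var (x i)

end TeamSem

namespace TeamSem

/-! The proof counts. In a fixed model, cover the family of teams satisfying a formula by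
subfamilies that are convex and closed under binary unions; the least number needed is its upper
dimension. Literals need one subfamily. For `∧` and `∨` the numbers multiply, and a quantifier never
raises the number, whatever class of relations it admits (`UnionConvex.choice`). So in models of
size `n` the dimension of a formula is at most a fixed power of a common bound for its atoms, with
an exponent that depends on the formula and not on the model (`Fmla.coverable_sat`).

Atoms are bounded in `Atom.coverable_sat`: a `j`-ary dependence atom by `n ^ n ^ j`, a constancy
atom by a power of `n`, every other `j`-ary atom by `(2 ^ n ^ j) ^ 2`. Conversely,
`Coverable.card_le` bounds dimensions from below by exhibiting many satisfying teams, no two of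
which fit in one subfamily. This gives at least `n ^ n ^ k` for `k`-ary dependence, and at least `2
^ (n - 2) ^ k` for the other four kinds of `k`-ary atoms considered.

Growth rates now decide. No power `(2 ^ n ^ k) ^ c = (2 ^ c) ^ n ^ k` dominates `n ^ n ^ k`, which
is (a). No power of `n ^ n ^ (k - 1)` dominates `2 ^ (n - 2) ^ k`, which is (b)–(e). The vocabulary
plays no role: any structure on the domain will do. -/

/-! ### Upper dimension of families of teams -/

section Families

variable {X Y β : Type}

/-- A family of sets that is convex and closed under binary unions. -/
structure UnionConvex (D : Set X → Prop) : Prop where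
  convex : ∀ {A B C : Set X}, D A → D C → A ⊆ B → B ⊆ C → D B
  union : ∀ {A B : Set X}, D A → D B → D (A ∪ B)

/-- The family `𝒜` is a union of at most `N` convex families closed under binary unions. -/
def Coverable (N : ℕ) (𝒜 : Set X → Prop) : Prop :=
  ∃ (ι : Type) (_ : Finite ι) (D : ι → Set X → Prop), Nat.card ι ≤ N ∧
    (∀ i, UnionConvex (D i)) ∧ ∀ T, 𝒜 T ↔ ∃ i, D i T

theorem Coverable.mono {N N' : ℕ} {𝒜 : Set X → Prop} (h : Coverable N 𝒜) (hN : N ≤ N') :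
    Coverable N' 𝒜 := by
  obtain ⟨ι, hι, D, hc, hD⟩ := h
  exact ⟨ι, hι, D, hc.trans hN, hD⟩

theorem UnionConvex.coverable {𝒜 : Set X → Prop} (h : UnionConvex 𝒜) : Coverable 1 𝒜 :=
  ⟨Unit, inferInstance, fun _ => 𝒜, by simp, fun _ => h, fun T => by simp⟩

theorem unionConvex_forall_mem (p : X → Prop) : UnionConvex fun T : Set X => ∀ s ∈ T, p s where
  convex _ hC _ hBC s hs := hC s (hBC hs)
  union hA hB s hs := hs.elim (hA s) (hB s)

/-- Families given by an upper bound on the members and by a monotone condition. -/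
theorem unionConvex_forall_mem_and (p : X → Prop) (q : Set X → Prop) (hq : Monotone q) :
    UnionConvex fun T : Set X => (∀ s ∈ T, p s) ∧ q T where
  convex hA hC hAB hBC := ⟨fun s hs => hC.1 s (hBC hs), hq hAB hA.2⟩
  union hA hB := ⟨fun s hs => hs.elim (hA.1 s) (hB.1 s), hq Set.subset_union_left hA.2⟩

theorem UnionConvex.and {D E : Set X → Prop} (hD : UnionConvex D) (hE : UnionConvex E) :
    UnionConvex fun T => D T ∧ E T where
  convex hA hC hAB hBC := ⟨hD.convex hA.1 hC.1 hAB hBC, hE.convex hA.2 hC.2 hAB hBC⟩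
  union hA hB := ⟨hD.union hA.1 hB.1, hE.union hA.2 hB.2⟩

/-- Convexity of the disjunction already needs union closure of both parts: with `A = U ∪ W` and `C
= U' ∪ W'`, the set `B` splits along `U ∪ U'` and `W ∪ W'`, and each piece lies between two members
of its family. This is why the two closure properties are bundled. -/
theorem UnionConvex.or {D E : Set X → Prop} (hD : UnionConvex D) (hE : UnionConvex E) :
    UnionConvex fun T => ∃ U W, T = U ∪ W ∧ D U ∧ E W where
  convex := by
    rintro _ B _ ⟨U, W, rfl, hU, hW⟩ ⟨U', W', rfl, hU', hW'⟩ hAB hBC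
    refine ⟨B ∩ (U ∪ U'), B ∩ (W ∪ W'), ?_, ?_, ?_⟩
    · rw [← Set.inter_union_distrib_left, eq_comm, Set.inter_eq_left]
      intro s hs
      rcases hBC hs with h | h
      · exact Or.inl (Or.inr h)
      · exact Or.inr (Or.inr h)
    · exact hD.convex hU (hD.union hU hU')
        (fun s hs => ⟨hAB (Or.inl hs), Or.inl hs⟩) Set.inter_subset_right
    · exact hE.convex hW (hE.union hW hW')
        (fun s hs => ⟨hAB (Or.inr hs), Or.inl hs⟩) Set.inter_subset_right
  union := by
    rintro _ _ ⟨U, W, rfl, hU, hW⟩ ⟨U', W', rfl, hU', hW'⟩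
    exact ⟨U ∪ U', W ∪ W', Set.union_union_union_comm _ _ _ _, hD.union hU hU', hE.union hW hW'⟩

/-- Quantification: the members of a set are replaced by sets of their extensions, chosen among
admissible ones. -/
theorem UnionConvex.choice {D : Set Y → Prop} (hD : UnionConvex D) (K : β → Prop)
    (e : X → β → Set Y) :
    UnionConvex fun T => ∃ F : X → β, (∀ s ∈ T, K (F s)) ∧ D (⋃ s ∈ T, e s (F s)) := by
  classical
  -- Serves both convexity and union closure. The choice is `F` on `A` and `G` elsewhere, so the
  -- resulting team lies between the one for `F` on `A` and its union with the one for `G` on `C`.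
  have key : ∀ {A B C : Set X} {F G : X → β}, (∀ s ∈ A, K (F s)) → (∀ s ∈ C, K (G s)) →
      D (⋃ s ∈ A, e s (F s)) → D (⋃ s ∈ C, e s (G s)) → A ⊆ B → B ⊆ A ∪ C →
      ∃ H : X → β, (∀ s ∈ B, K (H s)) ∧ D (⋃ s ∈ B, e s (H s)) := by
    intro A B C F G hF hG hA hC hAB hBC
    refine ⟨fun s => if s ∈ A then F s else G s, fun s hs => ?_,
      hD.convex hA (hD.union hA hC) ?_ ?_⟩
    · by_cases h : s ∈ A
      · simpa [h] using hF s h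
      · simpa [h] using hG s ((hBC hs).resolve_left h)
    · refine Set.iUnion₂_subset fun s hs t ht => ?_
      exact Set.mem_biUnion (hAB hs) (by simpa [hs] using ht)
    · refine Set.iUnion₂_subset fun s hs t ht => ?_
      by_cases h : s ∈ A
      · exact Or.inl (Set.mem_biUnion h (by simpa [h] using ht))
      · exact Or.inr (Set.mem_biUnion ((hBC hs).resolve_left h) (by simpa [h] using ht))
  constructor
  · rintro A B C ⟨F, hF, hA⟩ ⟨G, hG, hC⟩ hAB hBC
    exact key hF hG hA hC hAB (hBC.trans Set.subset_union_right)
  · rintro A B ⟨F, hF, hA⟩ ⟨G, hG, hB⟩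
    exact key hF hG hA hB Set.subset_union_left subset_rfl

theorem Coverable.and {N N' : ℕ} {𝒜 ℬ : Set X → Prop} (hA : Coverable N 𝒜)
    (hB : Coverable N' ℬ) : Coverable (N * N') fun T => 𝒜 T ∧ ℬ T := by
  obtain ⟨ι, _, D, hc, hD, hD'⟩ := hA
  obtain ⟨κ, _, E, hc', hE, hE'⟩ := hB
  refine ⟨ι × κ, inferInstance, fun i T => D i.1 T ∧ E i.2 T,
    by rw [Nat.card_prod]; exact Nat.mul_le_mul hc hc', fun i => (hD i.1).and (hE i.2), fun T => ?_⟩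
  constructor
  · rintro ⟨hA, hB⟩
    obtain ⟨i, hi⟩ := (hD' T).1 hA
    obtain ⟨j, hj⟩ := (hE' T).1 hB
    exact ⟨(i, j), hi, hj⟩
  · rintro ⟨i, hi, hj⟩
    exact ⟨(hD' T).2 ⟨_, hi⟩, (hE' T).2 ⟨_, hj⟩⟩

theorem Coverable.or {N N' : ℕ} {𝒜 ℬ : Set X → Prop} (hA : Coverable N 𝒜)
    (hB : Coverable N' ℬ) : Coverable (N * N') fun T => ∃ U W, T = U ∪ W ∧ 𝒜 U ∧ ℬ W := by
  obtain ⟨ι, _, D, hc, hD, hD'⟩ := hA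
  obtain ⟨κ, _, E, hc', hE, hE'⟩ := hB
  refine ⟨ι × κ, inferInstance, fun i T => ∃ U W, T = U ∪ W ∧ D i.1 U ∧ E i.2 W,
    by rw [Nat.card_prod]; exact Nat.mul_le_mul hc hc', fun i => (hD i.1).or (hE i.2), fun T => ?_⟩
  constructor
  · rintro ⟨U, W, rfl, hU, hW⟩
    obtain ⟨i, hi⟩ := (hD' U).1 hU
    obtain ⟨j, hj⟩ := (hE' W).1 hW
    exact ⟨(i, j), U, W, rfl, hi, hj⟩
  · rintro ⟨i, U, W, rfl, hU, hW⟩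
    exact ⟨U, W, rfl, (hD' U).2 ⟨_, hU⟩, (hE' W).2 ⟨_, hW⟩⟩

theorem Coverable.choice {N : ℕ} {𝒜 : Set Y → Prop} (h : Coverable N 𝒜) (K : β → Prop)
    (e : X → β → Set Y) :
    Coverable N fun T => ∃ F : X → β, (∀ s ∈ T, K (F s)) ∧ 𝒜 (⋃ s ∈ T, e s (F s)) := by
  obtain ⟨ι, hι, D, hc, hD, hD'⟩ := h
  refine ⟨ι, hι, _, hc, fun i => (hD i).choice K e, fun T => ?_⟩
  constructor
  · rintro ⟨F, hF, h⟩
    obtain ⟨i, hi⟩ := (hD' _).1 h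
    exact ⟨i, F, hF, hi⟩
  · rintro ⟨i, F, hF, hi⟩
    exact ⟨F, hF, (hD' _).2 ⟨i, hi⟩⟩

/-- A lower bound on the number of families in a cover: no two of the members `A i` of `𝒜` lie in
a common convex subfamily of `𝒜` closed under unions. -/
theorem Coverable.card_le {N : ℕ} {𝒜 : Set X → Prop} (h : Coverable N 𝒜) {I : Type}
    (A : I → Set X) (hA : ∀ i, 𝒜 (A i))
    (hsep : ∀ i j, i ≠ j → ∃ B, ¬ 𝒜 B ∧ B ⊆ A i ∪ A j ∧ (A i ⊆ B ∨ A j ⊆ B)) :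
    Nat.card I ≤ N := by
  obtain ⟨ι, hι, D, hc, hD, hD'⟩ := h
  choose f hf using fun i => (hD' (A i)).1 (hA i)
  refine (Nat.card_le_card_of_injective f fun i j hij => ?_).trans hc
  by_contra hne
  obtain ⟨B, hB, hBs, hB'⟩ := hsep i j hne
  have hj := hf j
  rw [← hij] at hj
  have hu := (hD (f i)).union (hf i) hj
  -- A common subfamily would contain `A i ∪ A j`, hence by convexity also `B`.
  refine hB ((hD' B).2 ⟨f i, ?_⟩)
  rcases hB' with h | h
  · exact (hD (f i)).convex (hf i) hu h hBs
  · exact (hD (f i)).convex hj hu h hBs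

end Families

/-! ### Upper bounds for atoms -/

section Atoms

variable {τ : Type u} {S M : Type}

/-- An upper bound for the upper dimension of an atom in a model with `n` elements. -/
def Atom.dimBound (n : ℕ) : Atom τ → ℕ
  | @Atom.dep _ k _ _ => n ^ n ^ k
  | @Atom.const _ l _ => n ^ l
  -- The square is for independence atoms, whose covers are indexed by two relations; elsewhere it
  -- is slack.
  | α => (2 ^ n ^ α.arity) ^ 2

theorem card_tuple [Finite M] (k : ℕ) : Nat.card (Fin k → M) = Nat.card M ^ k := by
  simp [Nat.card_fun]

theorem card_set (α : Type) [Finite α] : Nat.card (Set α) = 2 ^ Nat.card α := by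
  have := Fintype.ofFinite α
  classical
  simp [Nat.card_eq_fintype_card]

/-- Each cover is indexed by a guess that makes the atom local: a function for dependence, a value
for constancy, a relation for the rest. Once it is fixed, the atom follows from a condition on
single assignments together with, at most, a condition preserved by enlarging the team. -/
theorem Atom.coverable_sat [Finite M] [Nonempty M] (ev : S → τ → M) (α : Atom τ) :
    Coverable (α.dimBound (Nat.card M)) fun T => α.Sat ev T := by
  have hset : ∀ j, Nat.card (Set (Fin j → M)) = 2 ^ Nat.card M ^ j := fun j => by
    rw [card_set, card_tuple]
  have hsq : ∀ a : ℕ, 2 ^ a ≤ (2 ^ a) ^ 2 := fun a => Nat.le_self_pow two_ne_zero _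
  cases α with
  | @dep k x y =>
    refine ⟨(Fin k → M) → M, inferInstance, fun f T => ∀ s ∈ T, ev s y = f fun i => ev s (x i),
      by simp [Atom.dimBound, Nat.card_fun], fun f => unionConvex_forall_mem _, fun T => ?_⟩
    constructor
    · intro h
      classical
      -- The value off the tuples occurring in `T` is irrelevant.
      refine ⟨fun a => if ha : ∃ s ∈ T, (fun i => ev s (x i)) = a then ev ha.choose y
        else Classical.arbitrary M, fun s hs => ?_⟩
      have ha : ∃ s' ∈ T, (fun i => ev s' (x i)) = fun i => ev s (x i) := ⟨s, hs, rfl⟩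
      dsimp only
      rw [dif_pos ha]
      exact h s hs _ ha.choose_spec.1 fun i => (congrFun ha.choose_spec.2 i).symm
    · rintro ⟨f, hf⟩ s hs s' hs' h
      rw [hf s hs, hf s' hs', funext h]
  | @const l y =>
    refine ⟨Fin l → M, inferInstance, fun c T => ∀ s ∈ T, ∀ i, ev s (y i) = c i,
      by simp [Atom.dimBound, Nat.card_fun], fun f => unionConvex_forall_mem _, fun T => ?_⟩
    constructor
    · intro h
      rcases T.eq_empty_or_nonempty with rfl | ⟨s, hs⟩
      · exact ⟨Classical.arbitrary _, by simp⟩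
      · exact ⟨fun i => ev s (y i), fun s' hs' i => h s' hs' s hs i⟩
    · rintro ⟨c, hc⟩ s hs s' hs' i
      rw [hc s hs, hc s' hs']
  | @excl k hk x y =>
    refine ⟨Set (Fin k → M), inferInstance,
      fun R T => ∀ s ∈ T, (fun i => ev s (x i)) ∈ R ∧ (fun i => ev s (y i)) ∉ R,
      by simpa [Atom.dimBound, hset, Atom.arity] using hsq _,
      fun R => unionConvex_forall_mem _, fun T => ?_⟩
    constructor
    · intro h
      refine ⟨(fun s i => ev s (x i)) '' T, fun s hs => ⟨⟨s, hs, rfl⟩, ?_⟩⟩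
      rintro ⟨s', hs', he⟩
      exact h s' hs' s hs (congrFun he)
    · rintro ⟨R, hR⟩ s hs s' hs' h
      exact (hR s' hs').2 (funext h ▸ (hR s hs).1)
  | @incl k hk x y =>
    refine ⟨Set (Fin k → M), inferInstance,
      fun R T => (∀ s ∈ T, (fun i => ev s (x i)) ∈ R) ∧ R ⊆ (fun s i => ev s (y i)) '' T,
      by simpa [Atom.dimBound, hset, Atom.arity] using hsq _,
      fun R => unionConvex_forall_mem_and _ _ fun A B hAB h => h.trans (Set.image_mono hAB),
      fun T => ?_⟩
    constructor
    · intro h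
      refine ⟨(fun s i => ev s (x i)) '' T, fun s hs => ⟨s, hs, rfl⟩, ?_⟩
      rintro _ ⟨s, hs, rfl⟩
      obtain ⟨s', hs', he⟩ := h s hs
      exact ⟨s', hs', (funext he).symm⟩
    · rintro ⟨R, hR, hR'⟩ s hs
      obtain ⟨s', hs', he⟩ := hR' (hR s hs)
      exact ⟨s', hs', fun i => (congrFun he i).symm⟩
  | @anon k hk x y =>
    refine ⟨Set (Fin k → M), inferInstance,
      fun R T => (∀ s ∈ T, (fun i => ev s (x i)) ∈ R) ∧ ∀ a ∈ R, ∃ s ∈ T, ∃ s' ∈ T,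
        (fun i => ev s (x i)) = a ∧ (fun i => ev s' (x i)) = a ∧ ev s y ≠ ev s' y,
      by simpa [Atom.dimBound, hset, Atom.arity] using hsq _,
      fun R => unionConvex_forall_mem_and _ _ fun A B hAB h a ha => ?_, fun T => ?_⟩
    · obtain ⟨s, hs, s', hs', h⟩ := h a ha
      exact ⟨s, hAB hs, s', hAB hs', h⟩
    constructor
    · intro h
      refine ⟨(fun s i => ev s (x i)) '' T, fun s hs => ⟨s, hs, rfl⟩, ?_⟩
      rintro _ ⟨s, hs, rfl⟩
      obtain ⟨s', hs', he, hy⟩ := h s hs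
      exact ⟨s, hs, s', hs', rfl, (funext he).symm, hy⟩
    · rintro ⟨R, hR, hR'⟩ s hs
      obtain ⟨s₁, hs₁, s₂, hs₂, h₁, h₂, hne⟩ := hR' _ (hR s hs)
      by_cases h : ev s y = ev s₁ y
      · exact ⟨s₂, hs₂, fun i => (congrFun h₂ i).symm, h ▸ hne⟩
      · exact ⟨s₁, hs₁, fun i => (congrFun h₁ i).symm, h⟩
  | @indep p q m hp hq x y z =>
    -- The guess is the pair of projections of the team to `(z, x)` and `(z, y)`; the monotone
    -- condition says that the team realizes their join over `z`.
    refine ⟨Set ((Fin m → M) × (Fin p → M)) × Set ((Fin m → M) × (Fin q → M)), inferInstance,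
      fun R T => (∀ s ∈ T, (fun i => ev s (z i), fun i => ev s (x i)) ∈ R.1 ∧
          (fun i => ev s (z i), fun i => ev s (y i)) ∈ R.2) ∧
        ∀ c a b, (c, a) ∈ R.1 → (c, b) ∈ R.2 → ∃ s ∈ T, (fun i => ev s (z i)) = c ∧
          (fun i => ev s (x i)) = a ∧ (fun i => ev s (y i)) = b,
      ?_, fun R => unionConvex_forall_mem_and _ _ fun A B hAB h c a b ha hb => ?_, fun T => ?_⟩
    · have hM : 0 < Nat.card M := Nat.card_pos
      simp only [Nat.card_prod, card_set, card_tuple, Atom.dimBound, Atom.arity,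
        ← pow_add (Nat.card M) m]
      rw [sq]
      exact Nat.mul_le_mul
        (Nat.pow_le_pow_right two_pos (Nat.pow_le_pow_right hM
          (Nat.add_le_add_left (le_max_left p q) m)))
        (Nat.pow_le_pow_right two_pos (Nat.pow_le_pow_right hM
          (Nat.add_le_add_left (le_max_right p q) m)))
    · obtain ⟨s, hs, h⟩ := h c a b ha hb
      exact ⟨s, hAB hs, h⟩
    constructor
    · intro h
      refine ⟨((fun s => (fun i => ev s (z i), fun i => ev s (x i))) '' T,
        (fun s => (fun i => ev s (z i), fun i => ev s (y i))) '' T),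
        fun s hs => ⟨⟨s, hs, rfl⟩, ⟨s, hs, rfl⟩⟩, ?_⟩
      rintro c a b ⟨s, hs, he⟩ ⟨s', hs', he'⟩
      obtain ⟨rfl, rfl⟩ := Prod.mk.inj he
      obtain ⟨hz, rfl⟩ := Prod.mk.inj he'
      obtain ⟨s'', hs'', h₁, h₂, h₃⟩ := h s hs s' hs' fun i => (congrFun hz i).symm
      exact ⟨s'', hs'', funext h₁, funext h₂, funext h₃⟩
    · rintro ⟨R, hR, hR'⟩ s hs s' hs' hz
      have hb := (hR s' hs').2
      rw [← funext hz] at hb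
      obtain ⟨s'', hs'', h₁, h₂, h₃⟩ := hR' _ _ _ (hR s hs).1 hb
      exact ⟨s'', hs'', congrFun h₁, congrFun h₂, congrFun h₃⟩
  | @general k C x =>
    refine ⟨{R : Set (Fin k → M) // C.mem M R}, inferInstance,
      fun R T => (∀ s ∈ T, (fun i => ev s (x i)) ∈ R.1) ∧ R.1 ⊆ (fun s i => ev s (x i)) '' T,
      ?_, fun R => unionConvex_forall_mem_and _ _ fun A B hAB h => h.trans (Set.image_mono hAB),
      fun T => ?_⟩
    · refine (Nat.card_le_card_of_injective _ Subtype.val_injective).trans ?_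
      simpa [Atom.dimBound, hset, Atom.arity] using hsq _
    constructor
    · intro h
      exact ⟨⟨_, h⟩, fun s hs => ⟨s, hs, rfl⟩, subset_rfl⟩
    · rintro ⟨⟨R, hC⟩, hR, hR'⟩
      have : (fun s i => ev s (x i)) '' T = R :=
        (Set.image_subset_iff.2 hR).antisymm hR'
      simpa only [Atom.Sat, this] using hC

end Atoms

/-! ### Upper bounds for formulas -/

section Formulas

variable {L : FirstOrder.Language.{u, v}}

/-- Brings quantification into the assignmentwise form required by `Coverable.choice`. -/
theorem supp_eq_biUnion {V : Finset ℕ} {M : Type} (T : Set (V → M)) (x : ℕ)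
    (F : (V → M) → Set M) : supp T x F = ⋃ s ∈ T, supp {s} x fun _ => F s := by
  ext t
  simp only [supp, Set.mem_ofPred_eq, Set.mem_iUnion, Set.mem_singleton_iff, exists_eq_left,
    exists_prop]

theorem suppTuple_eq_biUnion {V : Finset ℕ} {M : Type} {r : ℕ} (T : Set (V → M)) (y : Fin r ↪ ℕ)
    (F : (V → M) → Set (Fin r → M)) :
    suppTuple T y F = ⋃ s ∈ T, suppTuple {s} y fun _ => F s := by
  ext t
  simp only [suppTuple, Set.mem_ofPred_eq, Set.mem_iUnion, Set.mem_singleton_iff, exists_eq_left,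
    exists_prop]

/-- If the upper dimensions of the atoms are bounded by powers of `b n`, where `n` is the size of
the model, then so are the upper dimensions of formulas. -/
theorem Fmla.coverable_sat (b : ℕ → ℕ) (P : (V : Finset ℕ) → Atom (L.Term V) → Prop)
    (hP : ∀ V α, P V α → ∃ c, ∀ n, 2 ≤ n → α.dimBound n ≤ b n ^ c)
    {V : Finset ℕ} (φ : Fmla L V) (hφ : φ.AtomsIn P) :
    ∃ c, ∀ (M : Type) [Finite M] [Nontrivial M] [L.Structure M],
      Coverable (b (Nat.card M) ^ c) fun T : Set (V → M) => φ.Sat T := by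
  induction φ with
  | eq t₁ t₂ => exact ⟨0, fun M _ _ _ => by
      simpa only [Fmla.Sat, pow_zero] using (unionConvex_forall_mem _).coverable⟩
  | neq t₁ t₂ => exact ⟨0, fun M _ _ _ => by
      simpa only [Fmla.Sat, pow_zero] using (unionConvex_forall_mem _).coverable⟩
  | rel R t => exact ⟨0, fun M _ _ _ => by
      simpa only [Fmla.Sat, pow_zero] using (unionConvex_forall_mem _).coverable⟩
  | nrel R t => exact ⟨0, fun M _ _ _ => by
      simpa only [Fmla.Sat, pow_zero] using (unionConvex_forall_mem _).coverable⟩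
  | @atom V α =>
    obtain ⟨c, hc⟩ := hP V α hφ
    refine ⟨c, fun M _ _ _ => ?_⟩
    simpa only [Fmla.Sat] using
      (α.coverable_sat fun (s : V → M) t => t.realize s).mono (hc _ Finite.one_lt_card)
  | and φ ψ ihφ ihψ =>
    obtain ⟨c, hc⟩ := ihφ hφ.1
    obtain ⟨d, hd⟩ := ihψ hφ.2
    refine ⟨c + d, fun M _ _ _ => ?_⟩
    simpa only [Fmla.Sat, pow_add] using (hc M).and (hd M)
  | or φ ψ ihφ ihψ =>
    obtain ⟨c, hc⟩ := ihφ hφ.1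
    obtain ⟨d, hd⟩ := ihψ hφ.2
    refine ⟨c + d, fun M _ _ _ => ?_⟩
    simpa only [Fmla.Sat, pow_add] using (hc M).or (hd M)
  | @ex V x φ ih =>
    obtain ⟨c, hc⟩ := ih hφ
    refine ⟨c, fun M _ _ _ => ?_⟩
    have := (hc M).choice Set.Nonempty fun (s : V → M) A => supp {s} x fun _ => A
    simpa only [Fmla.Sat, ← supp_eq_biUnion] using this
  | @all V x φ ih =>
    obtain ⟨c, hc⟩ := ih hφ
    refine ⟨c, fun M _ _ _ => ?_⟩
    -- The universal quantifier is a choice with a single option.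
    have := (hc M).choice (fun _ : Unit => True)
      fun (s : V → M) _ => supp {s} x fun _ => Set.univ
    simpa only [Fmla.Sat, ← supp_eq_biUnion _ x fun _ => Set.univ, implies_true, true_and,
      exists_const] using this
  | @quant V r hr K y φ ih =>
    obtain ⟨c, hc⟩ := ih hφ
    refine ⟨c, fun M _ _ _ => ?_⟩
    have := (hc M).choice (K.mem M) fun (s : V → M) A => suppTuple {s} y fun _ => A
    simpa only [Fmla.Sat, ← suppTuple_eq_biUnion] using this

/-- A structure on a nonempty type, with constant functions and empty relations. -/
noncomputable abbrev trivialStructure (L : FirstOrder.Language.{u, v}) (M : Type) [Nonempty M] :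
    L.Structure M where
  funMap _ _ := Classical.arbitrary M
  RelMap _ _ := False

/-- A definable atom has upper dimension bounded by a power of `b n`, if the atoms of the
logic do. -/
theorem Definable.exists_coverable (b : ℕ → ℕ) {P : (V : Finset ℕ) → Atom (L.Term V) → Prop}
    (hP : ∀ V α, P V α → ∃ c, ∀ n, 2 ≤ n → α.dimBound n ≤ b n ^ c)
    {V : Finset ℕ} {α : Atom (L.Term V)} (h : Definable L P α) :
    ∃ c, ∀ (M : Type) [Finite M] [Nontrivial M] [L.Structure M],
      Coverable (b (Nat.card M) ^ c)
        fun T : Set (V → M) => α.Sat (fun s t => t.realize s) T := by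
  obtain ⟨φ, hφ, hα⟩ := h
  obtain ⟨c, hc⟩ := φ.coverable_sat b P hP hφ
  refine ⟨c, fun M _ _ _ => ?_⟩
  simpa only [hα] using hc M

end Formulas

/-! ### Growth rates -/

section Growth

variable {τ : Type u}

theorem Atom.exists_dimBound_le_of_arity_lt {k : ℕ} (α : Atom τ) (h : α.arity < k) :
    ∃ c, ∀ n, 2 ≤ n → α.dimBound n ≤ (n ^ n ^ (k - 1)) ^ c := by
  have key : ∀ n j, 2 ≤ n → j < k → n ^ n ^ j ≤ n ^ n ^ (k - 1) := fun n j hn hj =>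
    Nat.pow_le_pow_right (by omega) (Nat.pow_le_pow_right (by omega) (by omega))
  have key2 : ∀ n j, 2 ≤ n → j < k → (2 ^ n ^ j) ^ 2 ≤ (n ^ n ^ (k - 1)) ^ 2 := fun n j hn hj =>
    Nat.pow_le_pow_left ((Nat.pow_le_pow_left hn _).trans (key n j hn hj)) 2
  cases α with
  | dep x y => exact ⟨1, fun n hn => (key n _ hn h).trans (pow_one _).ge⟩
  | @const l y =>
    -- The length of a constancy tuple is not bounded by `k`, so it goes into the exponent.
    refine ⟨l, fun n hn => Nat.pow_le_pow_left ?_ l⟩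
    exact Nat.le_self_pow (pow_pos (by omega) _).ne' n
  | excl hk x y => exact ⟨2, fun n hn => key2 n _ hn h⟩
  | incl hk x y => exact ⟨2, fun n hn => key2 n _ hn h⟩
  | anon hk x y => exact ⟨2, fun n hn => key2 n _ hn h⟩
  | indep hk hl x y z => exact ⟨2, fun n hn => key2 n _ hn h⟩
  | general C x => exact ⟨2, fun n hn => key2 n _ hn h⟩

theorem Atom.exists_dimBound_le_of_notDepNorGeneral {k : ℕ} (hk : 0 < k) (α : Atom τ)
    (h : α.arity < k ∨ α.arity ≤ k ∧ α.NotDepNorGeneral) :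
    ∃ c, ∀ n, 2 ≤ n → α.dimBound n ≤ (2 ^ n ^ k) ^ c := by
  by_cases h' : α.arity < k
  · obtain ⟨c, hc⟩ := α.exists_dimBound_le_of_arity_lt h'
    refine ⟨c, fun n hn => (hc n hn).trans (Nat.pow_le_pow_left ?_ c)⟩
    calc n ^ n ^ (k - 1) ≤ (2 ^ n) ^ n ^ (k - 1) := Nat.pow_le_pow_left Nat.lt_two_pow_self.le _
      _ = 2 ^ n ^ k := by rw [← pow_mul, ← pow_succ', Nat.sub_add_cancel hk]
  · obtain ⟨ha, hα⟩ := h.resolve_left h'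
    have key : ∀ n j, 2 ≤ n → j ≤ k → (2 ^ n ^ j) ^ 2 ≤ (2 ^ n ^ k) ^ 2 := fun n j hn hj =>
      Nat.pow_le_pow_left (Nat.pow_le_pow_right two_pos (Nat.pow_le_pow_right (by omega) hj)) 2
    cases α with
    | dep x y => exact hα.elim
    | const y => exact (h' hk).elim
    | excl hk x y => exact ⟨2, fun n hn => key n _ hn ha⟩
    | incl hk x y => exact ⟨2, fun n hn => key n _ hn ha⟩
    | anon hk x y => exact ⟨2, fun n hn => key n _ hn ha⟩
    | indep hk hl x y z => exact ⟨2, fun n hn => key n _ hn ha⟩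
    | general C x => exact hα.elim

theorem exists_mul_succ_lt_two_pow (C : ℕ) : ∃ t, 0 < t ∧ C * (t + 1) < 2 ^ t := by
  -- Twice `a = 2 * C + 1`, so that `2 ^ t` is the square of `2 ^ a` and exceeds `a * a`.
  refine ⟨2 * (2 * C + 1), by omega, ?_⟩
  have h : 2 * C + 1 < 2 ^ (2 * C + 1) := Nat.lt_two_pow_self
  calc C * (2 * (2 * C + 1) + 1) < (2 * C + 1) * (2 * C + 1) := by nlinarith
    _ ≤ 2 ^ (2 * C + 1) * 2 ^ (2 * C + 1) := Nat.mul_le_mul h.le h.le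
    _ = 2 ^ (2 * (2 * C + 1)) := by rw [← pow_add, ← two_mul]

theorem exists_growth_lt {k : ℕ} (hk : 0 < k) (c : ℕ) :
    ∃ n, ((n + 2) ^ (n + 2) ^ (k - 1)) ^ c < 2 ^ n ^ k := by
  obtain ⟨t, ht, h⟩ := exists_mul_succ_lt_two_pow (2 ^ (k - 1) * c)
  have h2 : 2 ≤ 2 ^ t := Nat.le_self_pow ht.ne' 2
  have h3 : 2 ^ t + 2 ≤ 2 ^ (t + 1) := by rw [pow_succ]; omega
  -- For `n` a power of two, `n + 2 ≤ 2 * n = 2 ^ (t + 1)`, and the claim reduces to comparing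
  -- exponents of `2`.
  refine ⟨2 ^ t, ?_⟩
  calc ((2 ^ t + 2) ^ (2 ^ t + 2) ^ (k - 1)) ^ c
      ≤ ((2 ^ (t + 1)) ^ (2 ^ t + 2) ^ (k - 1)) ^ c :=
        Nat.pow_le_pow_left (Nat.pow_le_pow_left h3 _) c
    _ ≤ ((2 ^ (t + 1)) ^ (2 ^ (t + 1)) ^ (k - 1)) ^ c :=
        Nat.pow_le_pow_left (Nat.pow_le_pow_right (by positivity) (Nat.pow_le_pow_left h3 _)) c
    _ = 2 ^ ((2 ^ (k - 1) * c * (t + 1)) * (2 ^ t) ^ (k - 1)) := by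
        rw [← pow_mul, ← pow_mul, pow_succ 2 t, mul_pow]
        congr 1
        ring
    _ < 2 ^ (2 ^ t * (2 ^ t) ^ (k - 1)) :=
        Nat.pow_lt_pow_right one_lt_two (Nat.mul_lt_mul_of_pos_right h (by positivity))
    _ = 2 ^ (2 ^ t) ^ k := by rw [← pow_succ', Nat.sub_add_cancel hk]

end Growth

/-! ### Lower bounds -/

section LowerBounds

variable {ι κ M : Type}

/-- Values at distinct variables can be prescribed. -/
theorem exists_comp_eq {V : Type} [Nonempty M] {x : ι → V} (hx : Function.Injective x)
    (a : ι → M) : ∃ s : V → M, ∀ i, s (x i) = a i :=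
  ⟨Function.extend x a fun _ => Classical.arbitrary M, fun i => hx.extend_apply a _ i⟩

theorem exists_comp_eq₂ {V : Type} [Nonempty M] {x : ι → V} {y : κ → V}
    (h : Function.Injective (Sum.elim x y)) (a : ι → M) (b : κ → M) :
    ∃ s : V → M, (fun i => s (x i)) = a ∧ (fun i => s (y i)) = b := by
  obtain ⟨s, hs⟩ := exists_comp_eq h (Sum.elim a b)
  exact ⟨s, funext fun i => hs (.inl i), funext fun i => hs (.inr i)⟩

/-- The tuples of elements of `N ⊕ Bool` that lie in `R` or are constantly `inr false`. -/
def pointed {N : Type} (R : Set (ι → N)) : Set (ι → N ⊕ Bool) :=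
  {a | (∃ r ∈ R, a = fun i => .inl (r i)) ∨ a = fun _ => .inr false}

/-- `pointed R` still determines `R`, but always has a member and a non-member among the constant
tuples on the two added points. These fill the coordinates that a separating assignment leaves free.
-/
theorem mem_pointed_inl [Nonempty ι] {N : Type} {R : Set (ι → N)} {r : ι → N} :
    (fun i => Sum.inl (r i)) ∈ pointed R ↔ r ∈ R := by
  constructor
  · rintro (⟨r', hr', h⟩ | h)
    · have : r = r' := funext fun i => Sum.inl_injective (congrFun h i)
      exact this ▸ hr'
    · exact absurd (congrFun h (Classical.arbitrary ι)) (by simp)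
  · exact fun h => Or.inl ⟨r, h, rfl⟩

theorem false_mem_pointed {N : Type} (R : Set (ι → N)) : (fun _ => .inr false) ∈ pointed R :=
  Or.inr rfl

theorem true_notMem_pointed [Nonempty ι] {N : Type} (R : Set (ι → N)) :
    (fun _ => .inr true) ∉ pointed R := by
  rintro (⟨r, -, h⟩ | h)
  · exact absurd (congrFun h (Classical.arbitrary ι)) (by simp)
  · exact absurd (congrFun h (Classical.arbitrary ι)) (by simp)

/-- Asymmetric version of `Coverable.card_le` for families indexed by sets. -/
theorem Coverable.two_pow_le {X α : Type} [Finite α] {N : ℕ} {𝒜 : Set X → Prop}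
    (h : Coverable N 𝒜) (A : Set α → Set X) (hA : ∀ R, 𝒜 (A R))
    (hsep : ∀ R S r, r ∈ R → r ∉ S → ∃ B, ¬ 𝒜 B ∧ B ⊆ A R ∪ A S ∧ (A R ⊆ B ∨ A S ⊆ B)) :
    2 ^ Nat.card α ≤ N := by
  rw [← card_set]
  refine h.card_le A hA fun R S hne => ?_
  by_cases hRS : R ⊆ S
  · obtain ⟨r, hr, hr'⟩ := Set.not_subset.1 fun hSR => hne (hRS.antisymm hSR)
    obtain ⟨B, hB, hB', h⟩ := hsep S R r hr hr'
    exact ⟨B, hB, Set.union_comm _ _ ▸ hB', h.symm⟩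
  · obtain ⟨r, hr, hr'⟩ := Set.not_subset.1 hRS
    exact hsep R S r hr hr'

variable {V : Finset ℕ} {L : FirstOrder.Language.{u, v}} {N : Type} {D k p q m : ℕ}

/-- The teams are the full graphs of functions `f`; the union of two of them violates the dependence
wherever the functions differ. -/
theorem le_of_coverable_dep [Finite M] [Nonempty M] [L.Structure M]
    (x : Fin k → V) (y : V) (hx : Function.Injective x) (hy : ∀ i, x i ≠ y)
    (h : Coverable D fun T : Set (V → M) =>
      (Atom.dep (vars L x) (.var y)).Sat (fun s t => t.realize s) T) :
    Nat.card M ^ Nat.card M ^ k ≤ D := by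
  have hinj : Function.Injective (Sum.elim x fun _ : Unit => y) :=
    hx.sumElim (Function.injective_of_subsingleton _) fun i _ => hy i
  have hc : Nat.card ((Fin k → M) → M) = Nat.card M ^ Nat.card M ^ k := by
    simp [Nat.card_fun]
  rw [← hc]
  refine h.card_le (fun f => {s | s y = f fun i => s (x i)}) (fun f s hs s' hs' he => ?_)
    fun f g hne => ⟨_, fun hB => ?_, subset_rfl, Or.inl Set.subset_union_left⟩
  · simp only [vars, FirstOrder.Language.Term.realize_var] at he ⊢
    rw [hs, hs', funext he]
  · obtain ⟨a, ha⟩ := Function.ne_iff.1 hne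
    obtain ⟨s, hs, hsy⟩ := exists_comp_eq₂ hinj a fun _ => f a
    obtain ⟨s', hs', hsy'⟩ := exists_comp_eq₂ hinj a fun _ => g a
    have h1 : s y = f a := congrFun hsy ()
    have h2 : s' y = g a := congrFun hsy' ()
    refine ha (h1 ▸ h2 ▸ hB s (Or.inl ?_) s' (Or.inr ?_) fun i => ?_)
    · simp [hs, h1]
    · simp [hs', h2]
    · exact congrFun (hs.trans hs'.symm) i

/-- The union of the teams for `R` and `S` has `r` as a value of `x` (from `R`) and of `y` (from
`S`). -/
theorem le_of_coverable_excl [Finite N] [L.Structure (N ⊕ Bool)] (hk : 0 < k)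
    (x y : Fin k → V) (hxy : Function.Injective (Sum.elim x y))
    (h : Coverable D fun T : Set (V → N ⊕ Bool) =>
      (Atom.excl hk (vars L x) (vars L y)).Sat (fun s t => t.realize s) T) :
    2 ^ Nat.card N ^ k ≤ D := by
  have : Nonempty (Fin k) := ⟨⟨0, hk⟩⟩
  rw [← card_tuple]
  refine h.two_pow_le (fun R => {s | (fun i => s (x i)) ∈ pointed R ∧
    (fun i => s (y i)) ∉ pointed R}) (fun R s hs s' hs' he => hs'.2 ?_)
    fun R S r hr hr' => ⟨_, fun hB => ?_, subset_rfl, Or.inl Set.subset_union_left⟩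
  · exact funext he ▸ hs.1
  · obtain ⟨s, hs, hsy⟩ := exists_comp_eq₂ hxy (fun i => Sum.inl (r i)) fun _ => .inr true
    obtain ⟨s', hs', hsy'⟩ := exists_comp_eq₂ hxy (fun _ => .inr false) fun i => Sum.inl (r i)
    refine hB s (Or.inl ⟨?_, ?_⟩) s' (Or.inr ⟨?_, ?_⟩) fun i => congrFun (hs.trans hsy'.symm) i
    · rw [hs, mem_pointed_inl]
      exact hr
    · rw [hsy]
      exact true_notMem_pointed R
    · rw [hs']
      exact false_mem_pointed S
    · rw [hsy', mem_pointed_inl]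
      exact hr'

/-- One assignment from the team for `R`, with `x = r` and `y` a added constant tuple, spoils the
team for `S`: there `r` is never a value of `y`. -/
theorem le_of_coverable_incl [Finite N] [L.Structure (N ⊕ Bool)] (hk : 0 < k)
    (x y : Fin k → V) (hxy : Function.Injective (Sum.elim x y))
    (h : Coverable D fun T : Set (V → N ⊕ Bool) =>
      (Atom.incl hk (vars L x) (vars L y)).Sat (fun s t => t.realize s) T) :
    2 ^ Nat.card N ^ k ≤ D := by
  have : Nonempty (Fin k) := ⟨⟨0, hk⟩⟩
  rw [← card_tuple]
  refine h.two_pow_le (fun R => {s | (fun i => s (x i)) ∈ pointed R ∧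
    (fun i => s (y i)) ∈ pointed R}) (fun R s hs => ?_) fun R S r hr hr' => ?_
  · obtain ⟨s', hs', hsy'⟩ := exists_comp_eq₂ hxy (fun i => s (x i)) fun i => s (x i)
    refine ⟨s', ⟨?_, ?_⟩, fun i => (congrFun hsy' i).symm⟩
    · rw [hs']
      exact hs.1
    · rw [hsy']
      exact hs.1
  · obtain ⟨s, hs, hsy⟩ := exists_comp_eq₂ hxy (fun i => Sum.inl (r i)) fun _ => .inr false
    refine ⟨{s} ∪ _, fun hB => ?_, Set.union_subset_union_left _ (Set.singleton_subset_iff.2 ?_),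
      Or.inr Set.subset_union_right⟩
    · obtain ⟨s', hs', he⟩ := hB s (Or.inl rfl)
      have he' : (fun i => s' (y i)) = fun i => Sum.inl (r i) := (funext he).symm.trans hs
      rcases hs' with rfl | hs'
      · exact absurd (congrFun (hsy.symm.trans he') ⟨0, hk⟩) (by simp)
      · have := hs'.2
        rw [he', mem_pointed_inl] at this
        exact hr' this
    · refine ⟨?_, ?_⟩
      · rw [hs, mem_pointed_inl]
        exact hr
      · rw [hsy]
        exact false_mem_pointed R

/-- Adding to the team for `S` a single assignment with `x = r` leaves it without a partner. No
spare points are needed, so the bound uses the full size of the model. -/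
theorem le_of_coverable_anon [Finite M] [Nontrivial M] [L.Structure M] (hk : 0 < k)
    (x : Fin k → V) (y : V) (hx : Function.Injective x) (hy : ∀ i, x i ≠ y)
    (h : Coverable D fun T : Set (V → M) =>
      (Atom.anon hk (vars L x) (.var y)).Sat (fun s t => t.realize s) T) :
    2 ^ Nat.card M ^ k ≤ D := by
  have hinj : Function.Injective (Sum.elim x fun _ : Unit => y) :=
    hx.sumElim (Function.injective_of_subsingleton _) fun i _ => hy i
  rw [← card_tuple]
  refine h.two_pow_le (fun R => {s | (fun i => s (x i)) ∈ R}) (fun R s hs => ?_)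
    fun R S r hr hr' => ?_
  · obtain ⟨b, hb⟩ := exists_ne (s y)
    obtain ⟨s', hs', hsy'⟩ := exists_comp_eq₂ hinj (fun i => s (x i)) fun _ => b
    refine ⟨s', ?_, fun i => (congrFun hs' i).symm, fun he => hb ?_⟩
    · simpa only [Set.mem_ofPred_eq, hs'] using hs
    · exact (congrFun hsy' ()).symm.trans he.symm
  · obtain ⟨s, hs⟩ := exists_comp_eq hx r
    refine ⟨{s} ∪ _, fun hB => ?_, Set.union_subset_union_left _ (Set.singleton_subset_iff.2 ?_),
      Or.inr Set.subset_union_right⟩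
    · obtain ⟨s', hs', he, hne⟩ := hB s (Or.inl rfl)
      rcases hs' with rfl | hs'
      · exact hne rfl
      · have he' : (fun i => s' (x i)) = r := (funext he).symm.trans (funext hs)
        rw [Set.mem_ofPred_eq, he'] at hs'
        exact hr' hs'
    · simpa only [Set.mem_ofPred_eq, funext hs] using hr

/-- `R` prescribes which `x` may accompany a given `z`, while `y` is unrestricted. Add to the team
for `S` one assignment `s` with `(z, x) = r` and `y` constantly `inr false`. Against an `s'` with
the same `z` but `y` constantly `inr true`, independence demands `(z, x) = r` with the latter `y`:
neither `s` nor a member of the team for `S`. -/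
theorem le_of_coverable_indep [Finite N] [L.Structure (N ⊕ Bool)] (hp : 0 < p) (hq : 0 < q)
    (x : Fin p → V) (y : Fin q → V) (z : Fin m → V)
    (hinj : Function.Injective (Sum.elim (Sum.elim x y) z))
    (h : Coverable D fun T : Set (V → N ⊕ Bool) =>
      (Atom.indep hp hq (vars L x) (vars L y) (vars L z)).Sat (fun s t => t.realize s) T) :
    2 ^ Nat.card N ^ (m + p) ≤ D := by
  have : Nonempty (Fin p) := ⟨⟨0, hp⟩⟩
  have hex : ∀ (a : Fin p → N ⊕ Bool) (b : Fin q → N ⊕ Bool) (c : Fin m → N ⊕ Bool),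
      ∃ s : V → N ⊕ Bool, (fun i => s (x i)) = a ∧ (fun i => s (y i)) = b ∧
        (fun i => s (z i)) = c := fun a b c => by
    obtain ⟨s, hs, hsz⟩ := exists_comp_eq₂ hinj (Sum.elim a b) c
    exact ⟨s, funext fun i => congrFun hs (.inl i), funext fun i => congrFun hs (.inr i), hsz⟩
  have hc : Nat.card ((Fin m → N) × (Fin p → N)) = Nat.card N ^ (m + p) := by
    rw [Nat.card_prod, card_tuple, card_tuple, pow_add]
  rw [← hc]
  refine h.two_pow_le (fun R => {s | (fun i => s (x i)) ∈
    pointed {r | ∃ c, (c, r) ∈ R ∧ ∀ i, s (z i) = .inl (c i)}}) (fun R s hs s' hs' he => ?_)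
    fun R S r hr hr' => ?_
  · obtain ⟨s'', h₁, h₂, h₃⟩ := hex (fun i => s (x i)) (fun i => s' (y i)) fun i => s (z i)
    refine ⟨s'', ?_, congrFun h₃, congrFun h₁, congrFun h₂⟩
    rw [Set.mem_ofPred_eq, h₁]
    have hz : ∀ i, s'' (z i) = s (z i) := congrFun h₃
    simp only [hz]
    exact hs
  · obtain ⟨s, h₁, h₂, h₃⟩ := hex (fun i => .inl (r.2 i)) (fun _ => .inr false)
      fun i => .inl (r.1 i)
    obtain ⟨s', h₁', h₂', h₃'⟩ := hex (fun _ => .inr false) (fun _ => .inr true)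
      fun i => .inl (r.1 i)
    refine ⟨{s} ∪ _, fun hB => ?_, Set.union_subset_union_left _ (Set.singleton_subset_iff.2 ?_),
      Or.inr Set.subset_union_right⟩
    · have hs' : (fun i => s' (x i)) ∈
          pointed {r | ∃ c, (c, r) ∈ S ∧ ∀ i, s' (z i) = .inl (c i)} := h₁' ▸ false_mem_pointed _
      obtain ⟨s'', hs'', hz, hx, hy⟩ := hB s (Or.inl rfl) s' (Or.inr hs')
        fun i => congrFun (h₃.trans h₃'.symm) i
      rcases hs'' with rfl | hs''
      · have := (congrFun h₂ ⟨0, hq⟩).symm.trans ((hy ⟨0, hq⟩).trans (congrFun h₂' ⟨0, hq⟩))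
        exact absurd this (by simp)
      · have hx' : (fun i => s'' (x i)) = fun i => Sum.inl (r.2 i) := (funext hx).trans h₁
        rw [Set.mem_ofPred_eq, hx', mem_pointed_inl] at hs''
        obtain ⟨c, hc, hcz⟩ := hs''
        have : c = r.1 := funext fun i => Sum.inl_injective
          ((hcz i).symm.trans ((hz i).trans (congrFun h₃ i)))
        subst this
        exact hr' hc
    · rw [Set.mem_ofPred_eq, h₁, mem_pointed_inl]
      exact ⟨r.1, hr, congrFun h₃⟩

theorem indep_sat_comm {τ : Type u} {X : Type} (ev : X → τ → M) (hp : 0 < p) (hq : 0 < q)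
    (x : Fin p → τ) (y : Fin q → τ) (z : Fin m → τ) (T : Set X) :
    (Atom.indep hp hq x y z).Sat ev T ↔ (Atom.indep hq hp y x z).Sat ev T := by
  constructor
  all_goals
    intro h s hs s' hs' he
    obtain ⟨s'', hs'', h₁, h₂, h₃⟩ := h s' hs' s hs fun i => (he i).symm
    exact ⟨s'', hs'', fun i => (h₁ i).trans (he i).symm, h₃, h₂⟩

theorem le_of_coverable_indep_max [Finite N] [L.Structure (N ⊕ Bool)] (hp : 0 < p) (hq : 0 < q)
    (x : Fin p → V) (y : Fin q → V) (z : Fin m → V)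
    (hinj : Function.Injective (Sum.elim (Sum.elim x y) z))
    (h : Coverable D fun T : Set (V → N ⊕ Bool) =>
      (Atom.indep hp hq (vars L x) (vars L y) (vars L z)).Sat (fun s t => t.realize s) T) :
    2 ^ Nat.card N ^ (m + max p q) ≤ D := by
  rcases le_total q p with hqp | hpq
  · rw [max_eq_left hqp]
    exact le_of_coverable_indep hp hq x y z hinj h
  · rw [max_eq_right hpq]
    refine le_of_coverable_indep (L := L) hq hp y x z ?_ (by simpa only [indep_sat_comm] using h)
    have : Sum.elim (Sum.elim y x) z =
        Sum.elim (Sum.elim x y) z ∘ Sum.map Sum.swap id := by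
      ext ((i | i) | i) <;> rfl
    rw [this]
    exact hinj.comp (Sum.map_injective.2 ⟨Sum.swap_leftInverse.injective, Function.injective_id⟩)

end LowerBounds

/-- An atom whose upper dimension in models with `n + 2` elements is at least `2 ^ n ^ k` is not
definable from atoms of arity less than `k`. -/
theorem not_definable_below {L : FirstOrder.Language.{u, v}} {k : ℕ} (hk : 0 < k) {V : Finset ℕ}
    {α : Atom (L.Term V)}
    (h : ∀ (n D : ℕ) [L.Structure (Fin n ⊕ Bool)], (Coverable D fun T : Set (V → Fin n ⊕ Bool) =>
      α.Sat (fun s t => t.realize s) T) → 2 ^ n ^ k ≤ D) :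
    ¬ Definable L (Below L k) α := by
  intro hα
  obtain ⟨c, hc⟩ := hα.exists_coverable (fun n => n ^ n ^ (k - 1))
    fun _ β hβ => β.exists_dimBound_le_of_arity_lt hβ
  obtain ⟨n, hn⟩ := exists_growth_lt hk c
  let _ := trivialStructure L (Fin n ⊕ Bool)
  have : Nontrivial (Fin n ⊕ Bool) := Sum.inr_injective.nontrivial
  have hcard : Nat.card (Fin n ⊕ Bool) = n + 2 := by simp
  have := h n _ (hc (Fin n ⊕ Bool))
  rw [hcard] at this
  omega

end TeamSem

theorem mainTheorem1 (L : FirstOrder.Language.{u, v}) (k : ℕ) (hk : 0 < k) (V : Finset ℕ) :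
    -- (a) dependence
    (∀ (x : Fin k → V) (y : V), Function.Injective x → (∀ i, x i ≠ y) →
      ¬ TeamSem.Definable L (TeamSem.BelowOrNonDep L k)
        (.dep (TeamSem.vars L x) (FirstOrder.Language.Term.var y))) ∧
    -- (b) exclusion
    (∀ x y : Fin k → V, Function.Injective (Sum.elim x y) →
      ¬ TeamSem.Definable L (TeamSem.Below L k)
        (.excl hk (TeamSem.vars L x) (TeamSem.vars L y))) ∧
    -- (c) inclusion
    (∀ x y : Fin k → V, Function.Injective (Sum.elim x y) →
      ¬ TeamSem.Definable L (TeamSem.Below L k)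
        (.incl hk (TeamSem.vars L x) (TeamSem.vars L y))) ∧
    -- (d) anonymity
    (∀ (x : Fin k → V) (y : V), Function.Injective x → (∀ i, x i ≠ y) →
      ¬ TeamSem.Definable L (TeamSem.Below L k)
        (.anon hk (TeamSem.vars L x) (FirstOrder.Language.Term.var y))) ∧
    -- (e) independence, pure (`m = 0`) or conditional (`m > 0`)
    (∀ (p q m : ℕ) (hp : 0 < p) (hq : 0 < q), m + max p q = k →
      ∀ (x : Fin p → V) (y : Fin q → V) (z : Fin m → V),
        Function.Injective (Sum.elim (Sum.elim x y) z) →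
        ¬ TeamSem.Definable L (TeamSem.Below L k)
          (.indep hp hq (TeamSem.vars L x) (TeamSem.vars L y) (TeamSem.vars L z))) := by
  refine ⟨fun x y hx hy hdef => ?_, fun x y hxy => ?_, fun x y hxy => ?_, fun x y hx hy => ?_,
    fun p q m hp hq hpq x y z hinj => ?_⟩
  · obtain ⟨c, hc⟩ := hdef.exists_coverable (fun n => 2 ^ n ^ k)
      fun _ β hβ => β.exists_dimBound_le_of_notDepNorGeneral hk hβ
    -- Any size above `2 ^ c` gives `(2 ^ c) ^ n ^ k < n ^ n ^ k`.
    let _ := TeamSem.trivialStructure L (Fin (2 ^ c + 2))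
    have h := TeamSem.le_of_coverable_dep x y hx hy (hc (Fin (2 ^ c + 2)))
    rw [Nat.card_fin, ← pow_mul, mul_comm, pow_mul] at h
    exact h.not_gt (Nat.pow_lt_pow_left (by omega) (by positivity))
  · refine TeamSem.not_definable_below hk fun n D _ h => ?_
    simpa using TeamSem.le_of_coverable_excl hk x y hxy h
  · refine TeamSem.not_definable_below hk fun n D _ h => ?_
    simpa using TeamSem.le_of_coverable_incl hk x y hxy h
  · refine TeamSem.not_definable_below hk fun n D _ h => ?_
    have : Nontrivial (Fin n ⊕ Bool) := Sum.inr_injective.nontrivial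
    refine le_trans ?_ (TeamSem.le_of_coverable_anon hk x y hx hy h)
    exact Nat.pow_le_pow_right two_pos (Nat.pow_le_pow_left (by simp) k)
  · refine TeamSem.not_definable_below hk fun n D _ h => ?_
    simpa [hpq] using TeamSem.le_of_coverable_indep_max hp hq x y z hinj h
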